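/- **Theorem 8.** A Stirling permutation of order $n$ is a rearrangement $\sigma=\sigma_1\sigma_2\cdots\sigma_{2n}$ of the multiset $\{1,1,2,2,\ldots,n,n\}$ such that, for each $i\in\{1,\ldots,n\}$, every element between the two occurrences of $i$ is greater than $i$. It avoids the pattern $132$ if there are no indices $a<b<c$ with $\sigma_a<\sigma_c<\sigma_b$. Let $\mathcal{Q}_n(132)$ be the set of $132$-avoiding Stirling permutations of order $n$ (for $n=0$ it consists of the empty word), and let $\mathrm{plat}(\sigma)$, $\mathrm{des}(\sigma)$, $\mathrm{asc}(\sigma)$ denote the number of indices $1\le i\le 2n-1$ with $\sigma_i=\sigma_{i+1}$, $\sigma_i>\sigma_{i+1}$, $\sigma_i<\sigma_{i+1}$, respectively. Put $$C_{132}(x,p,q,r)=\sum_{n\ge 0}\ \sum_{\sigma\in\mathcal{Q}_n(132)}x^n\,p^{\mathrm{plat}(\sigma)}q^{\mathrm{des}(\sigma)}r^{\mathrm{asc}(\sigma)},$$ a formal power series in $x$, where $p,q,r$ are indeterminates or, more generally, arbitrary elements of a commutative ring. Then the power series $f=q\,C_{132}(x,p,q,r)-q+1$ satisfies $$f=1+px\left(q-2r+r\bigl(2+(pr-pq+q^2)x\bigr)f-pr^2xf^2\right)f.$$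 -/

import Mathlib

open PowerSeries

namespace StirlingPerm

/-- `σ` is a Stirling permutation of order `n`, written as a word: it is a rearrangement of the
multiset `{1, 1, 2, 2, …, n, n}`, and every letter `j` standing between the two occurrences of a
letter `i` is greater than `i`. (`<+` is the subsequence relation on words; since every letter
occurs exactly twice, `[i, j, i] <+ σ` says that `j` stands between the two occurrences of `i`.) -/
def IsStirling (n : ℕ) (σ : List ℕ) : Prop :=
  (σ : Multiset ℕ) = 2 • (Finset.Icc 1 n).val ∧ ∀ i j : ℕ, List.Sublist [i, j, i] σ → i < j

/-- `σ` contains the pattern `τ`: some subsequence `s` of `σ` of the same length as `τ` satisfies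
`s_a < s_b` whenever `τ_a < τ_b`. -/
def Contains (σ τ : List ℕ) : Prop :=
  ∃ s : List ℕ, List.Sublist s σ ∧ ∃ h : τ.length = s.length,
    ∀ a b : Fin τ.length, τ.get a < τ.get b → s.get (a.cast h) < s.get (b.cast h)

/-- `σ` avoids the pattern `τ`. -/
def Avoids (σ τ : List ℕ) : Prop := ¬ Contains σ τ

open Classical in
/-- The set of Stirling permutations of order `n` that avoid `τ`. -/
noncomputable def avoiders (n : ℕ) (τ : List ℕ) : Finset (List ℕ) :=
  (Multiset.lists (2 • (Finset.Icc 1 n).val)).toFinset.filter fun σ => IsStirling n σ ∧ Avoids σ τ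

theorem mem_avoiders {n : ℕ} {τ σ : List ℕ} :
    σ ∈ avoiders n τ ↔ IsStirling n σ ∧ Avoids σ τ := by
  classical
  simp only [avoiders, Finset.mem_filter, Multiset.mem_toFinset, Multiset.mem_lists_iff, and_iff_right_iff_imp]
  intro h
  exact h.1.1.symm

/-- The number of descents: positions `i` with `σ_i > σ_{i+1}`. The list `σ.zip σ.tail` consists
of the pairs `(σ_i, σ_{i+1})` of adjacent letters. -/
def des (σ : List ℕ) : ℕ := (σ.zip σ.tail).countP fun w => w.1 > w.2

/-- The number of ascents: positions `i` with `σ_i < σ_{i+1}`. -/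
def asc (σ : List ℕ) : ℕ := (σ.zip σ.tail).countP fun w => w.1 < w.2

/-- The number of plateaus: positions `i` with `σ_i = σ_{i+1}`. -/
def plat (σ : List ℕ) : ℕ := (σ.zip σ.tail).countP fun w => w.1 = w.2

/-- `C_{n,τ}(p,q,r) = ∑_σ p^{plat σ} q^{des σ} r^{asc σ}`, summed over the Stirling permutations `σ`
of order `n` that avoid `τ`. -/
noncomputable def avoidPoly {R : Type*} [CommRing R] (n : ℕ) (τ : List ℕ) (p q r : R) : R :=
  ∑ σ ∈ avoiders n τ, p ^ plat σ * q ^ des σ * r ^ asc σ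

/-- The formal power series `C_τ(x,p,q,r) = ∑_{n ≥ 0} C_{n,τ}(p,q,r) x^n` in `x`. -/
noncomputable def genFun {R : Type*} [CommRing R] (τ : List ℕ) (p q r : R) : PowerSeries R :=
  PowerSeries.mk fun n => avoidPoly n τ p q r

end StirlingPerm

/-! A nonempty 132-avoiding Stirling permutation ends in `b b`, or in `b b 1` with `b > 1`
(`IsGood.exists_suffix`). Before that suffix no letter below `b` precedes one above `b`, since `b`
would complete a 132. So the word is `α' β b b` or `α' β b b 1`, where `α'` is a good word `α`
shifted above `b`, and `β`, respectively `β 1`, is good of order `b - 1`. Conversely all such words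
are good, and the pieces are determined by the word (`sum_avoiders_filter_suffix`).

Let `G` be the generating function and `E` that of the words `β` with `β 1` good, `x` marking the
order of `β 1`. The block `α'` with the descent after it, if nonempty, contributes `f = 1 + q (G -
1)`; the pair `b b` gives `p`, and the ascent into it from a nonempty `β` gives `r`. Hence `G = 1 +
p x f (1 + r (G - 1)) + p q r x f E` (`avoidPoly_succ`) and `E = x f + p r x f E`
(`prefixPoly_succ`). Eliminating `G` and `E` gives the claim. -/

namespace StirlingPerm

/-! ### Subsequences and letter counts -/

section Words

theorem pair_sublist_append_iff {x y : ℕ} {l m : List ℕ} :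
    [x, y].Sublist (l ++ m) ↔ [x, y].Sublist l ∨ (x ∈ l ∧ y ∈ m) ∨ [x, y].Sublist m := by
  constructor
  · intro h
    obtain ⟨s, t, hst, hs, ht⟩ := List.sublist_append_iff.1 h
    rcases s with _ | ⟨a, _ | ⟨b, _ | ⟨c, s⟩⟩⟩ <;> simp at hst <;> aesop
  · rintro (h | ⟨h, h'⟩ | h)
    · exact h.trans (List.sublist_append_left _ _)
    · exact (List.singleton_sublist.2 h).append (List.singleton_sublist.2 h')
    · exact h.trans (List.sublist_append_right _ _)

theorem triple_sublist_append_iff {x y z : ℕ} {l m : List ℕ} :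
    [x, y, z].Sublist (l ++ m) ↔ [x, y, z].Sublist l ∨ ([x, y].Sublist l ∧ z ∈ m) ∨
      (x ∈ l ∧ [y, z].Sublist m) ∨ [x, y, z].Sublist m := by
  constructor
  · intro h
    obtain ⟨s, t, hst, hs, ht⟩ := List.sublist_append_iff.1 h
    rcases s with _ | ⟨a, _ | ⟨b, _ | ⟨c, _ | ⟨d, s⟩⟩⟩⟩ <;> simp at hst <;> aesop
  · rintro (h | ⟨h, h'⟩ | ⟨h, h'⟩ | h)
    · exact h.trans (List.sublist_append_left _ _)
    · exact h.append (List.singleton_sublist.2 h')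
    · exact (List.singleton_sublist.2 h).append h'
    · exact h.trans (List.sublist_append_right _ _)

theorem mem_of_pair_sublist {x y : ℕ} {l : List ℕ} (h : [x, y].Sublist l) : x ∈ l ∧ y ∈ l :=
  ⟨h.subset (by simp), h.subset (by simp)⟩

/-- A word without the letter `b` in which no letter below `b` precedes a letter above `b`
consists of its letters above `b` followed by its letters below `b`. -/
theorem eq_filter_append_filter {b : ℕ} {l : List ℕ} (hb : b ∉ l)
    (h : ∀ x y, [x, y].Sublist l → ¬(x < b ∧ b < y)) :
    l = l.filter (fun i => b < i) ++ l.filter (fun i => i < b) := by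
  induction l with
  | nil => rfl
  | cons a l ih =>
    have ih := ih (fun h' => hb (by simp [h'])) fun x y hxy => h x y (hxy.cons a)
    have hab : a ≠ b := fun h' => hb (by simp [h'])
    rcases lt_or_gt_of_ne hab with hlt | hlt
    · have hf : l.filter (fun i => b < i) = [] := by
        rw [List.filter_eq_nil_iff]
        intro y hy hby
        exact h a y ((List.singleton_sublist.2 hy).cons_cons a) ⟨hlt, by simpa using hby⟩
      rw [hf, List.nil_append] at ih
      simp only [List.filter_cons, hlt, hf, not_lt_of_gt hlt, decide_true, decide_false]
      simpa using ih
    · simp only [List.filter_cons, hlt, not_lt_of_gt hlt, decide_true, decide_false]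
      simpa using ih

theorem count_map_add (l : List ℕ) (b i : ℕ) :
    (l.map (· + b)).count i = if i < b then 0 else l.count (i - b) := by
  split_ifs with h
  · rw [List.count_eq_zero]
    simp only [List.mem_map, not_exists, not_and]
    intros; omega
  · obtain ⟨j, rfl⟩ := Nat.exists_eq_add_of_le (not_lt.1 h)
    rw [Nat.add_comm b j, Nat.add_sub_cancel]
    exact List.count_map_of_injective l _ (add_left_injective b) j

theorem count_filter_eq_ite (P : ℕ → Prop) [DecidablePred P] (l : List ℕ) (i : ℕ) :
    (l.filter (fun j => P j)).count i = if P i then l.count i else 0 := by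
  split_ifs with h
  · exact List.count_filter (by simpa using h)
  · rw [List.count_eq_zero]
    simp [h]

end Words

/-! ### Structure of 132-avoiding Stirling permutations -/

/-- The subsequences of length three allowed in a 132-avoiding Stirling permutation. -/
def HasGoodTriples (σ : List ℕ) : Prop :=
  ∀ x y z : ℕ, [x, y, z].Sublist σ → ¬(x < z ∧ z < y) ∧ (x = z → x < y)

theorem HasGoodTriples.of_sublist {σ τ : List ℕ} (h : HasGoodTriples τ) (hs : σ.Sublist τ) :
    HasGoodTriples σ := fun x y z hxyz => h x y z (hxyz.trans hs)

theorem hasGoodTriples_map_add {σ : List ℕ} {b : ℕ} :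
    HasGoodTriples (σ.map (· + b)) ↔ HasGoodTriples σ := by
  constructor
  · intro h x y z hs
    have := h (x + b) (y + b) (z + b) (hs.map (· + b))
    omega
  · intro h x y z hs
    obtain ⟨s, hs, he⟩ := List.sublist_map_iff.1 hs
    rcases s with _ | ⟨x', _ | ⟨y', _ | ⟨z', _ | ⟨d, s⟩⟩⟩⟩ <;>
      simp only [List.map_cons, List.map_nil, List.cons.injEq, List.nil_eq, and_false, and_true, List.cons_ne_nil] at he
    have := h x' y' z' hs
    omega

/-- `σ` is a 132-avoiding Stirling permutation of order `n`, in terms of letter counts and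
subsequences of length three. -/
def IsGood (n : ℕ) (σ : List ℕ) : Prop :=
  (∀ i, σ.count i = if 1 ≤ i ∧ i ≤ n then 2 else 0) ∧ HasGoodTriples σ

theorem contains_132_iff {σ : List ℕ} :
    Contains σ [1, 3, 2] ↔ ∃ x y z, [x, y, z].Sublist σ ∧ x < z ∧ z < y := by
  constructor
  · rintro ⟨s, hs, h, H⟩
    rcases s with _ | ⟨x, _ | ⟨y, _ | ⟨z, _ | ⟨d, s⟩⟩⟩⟩ <;> simp at h
    exact ⟨x, y, z, hs, H 0 2 (by simp), H 2 1 (by simp)⟩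
  · rintro ⟨x, y, z, hs, hxz, hzy⟩
    refine ⟨[x, y, z], hs, rfl, ?_⟩
    intro a b
    fin_cases a <;> fin_cases b <;> simp <;> omega

theorem mem_avoiders_132_iff {n : ℕ} {σ : List ℕ} :
    σ ∈ avoiders n [1, 3, 2] ↔ IsGood n σ := by
  rw [mem_avoiders, IsStirling, Avoids, contains_132_iff, IsGood, and_assoc]
  refine and_congr ?_ ?_
  · rw [Multiset.ext]
    refine forall_congr' fun i => ?_
    rw [Multiset.coe_count, Multiset.count_nsmul, Multiset.count_eq_of_nodup (Finset.nodup _)]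
    simp only [Finset.mem_val, Finset.mem_Icc, mul_ite, mul_one, mul_zero]
  · constructor
    · rintro ⟨h1, h2⟩ x y z hs
      refine ⟨fun h => h2 ⟨x, y, z, hs, h⟩, ?_⟩
      rintro rfl
      exact h1 x y hs
    · intro h
      refine ⟨fun i j hs => (h i j i hs).2 rfl, ?_⟩
      rintro ⟨x, y, z, hs, h'⟩
      exact (h x y z hs).1 h'

theorem IsGood.mem_iff {n : ℕ} {σ : List ℕ} (h : IsGood n σ) {i : ℕ} :
    i ∈ σ ↔ 1 ≤ i ∧ i ≤ n := by
  rw [← List.count_pos_iff, h.1 i]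
  split_ifs with h' <;> simp [h']

theorem isGood_zero_iff {σ : List ℕ} : IsGood 0 σ ↔ σ = [] := by
  constructor
  · intro h
    refine List.eq_nil_iff_forall_not_mem.2 fun i hi => ?_
    have := h.mem_iff.1 hi
    omega
  · rintro rfl
    refine ⟨fun i => ?_, fun x y z hs => by simp at hs⟩
    simp only [List.count_nil]
    split_ifs <;> omega

theorem exists_isGood_eq_map_add {l : List ℕ} {b k : ℕ}
    (hc : ∀ i, l.count i = if b + 1 ≤ i ∧ i ≤ b + k then 2 else 0) (ht : HasGoodTriples l) :
    ∃ α, IsGood k α ∧ l = α.map (· + b) := by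
  -- Truncated subtraction is undone here because every letter of `l` exceeds `b`.
  have hl : l = (l.map (· - b)).map (· + b) := by
    rw [List.map_map]
    conv_lhs => rw [← List.map_id l]
    refine List.map_congr_left fun i hi => ?_
    have := hc i
    have := List.count_pos_iff.2 hi
    simp only [id, Function.comp]
    split_ifs at * <;> omega
  refine ⟨l.map (· - b), ⟨fun i => ?_, ?_⟩, hl⟩
  · have h1 := hc (i + b)
    rw [hl, count_map_add, if_neg (by omega), Nat.add_sub_cancel] at h1
    rw [h1]
    split_ifs <;> omega
  · rwa [← hasGoodTriples_map_add (b := b), ← hl]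

/-- Splitting off the letters above `b` of a good word with suffix `b b` or `b b 1`. -/
theorem IsGood.exists_eq_append {n b : ℕ} {A t : List ℕ} (ht : t = [b, b] ∨ t = [b, b, 1])
    (h : IsGood (n + 1) (A ++ t)) :
    ∃ k m, k + m = n ∧ b = m + 1 ∧ ∃ α, IsGood k α ∧ ∃ β, IsGood m (β ++ t.drop 2) ∧
      A = α.map (· + b) ++ β := by
  have hbt : b ∈ t := by rcases ht with rfl | rfl <;> simp
  have hb := h.mem_iff.1 (List.mem_append_right A hbt)
  have hcount := h.1
  have htc : ∀ i, t.count i = (if i = b then 2 else 0) + (t.drop 2).count i := by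
    intro i
    rcases ht with rfl | rfl <;> simp only [List.count_cons, List.count_nil, List.drop] <;>
      simp only [beq_iff_eq] <;> split_ifs <;> omega
  have h1 : ∀ i, i ∈ t.drop 2 → i = 1 := by
    rcases ht with rfl | rfl <;> simp
  simp only [List.count_append, htc] at hcount
  have hbA : b ∉ A := by
    have := hcount b
    rw [if_pos rfl, if_pos hb] at this
    rw [← List.count_eq_zero]; omega
  have hb1 : 1 ∈ t.drop 2 → b ≠ 1 := by
    rintro h' rfl
    have h3 := hcount 1
    have := List.count_pos_iff.2 h'
    rw [if_pos rfl, if_pos hb] at h3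
    omega
  have hsplit := eq_filter_append_filter hbA fun x y hxy hlt =>
    (h.2 x y b (triple_sublist_append_iff.2 (.inr (.inl ⟨hxy, hbt⟩)))).1 hlt
  have hd : ∀ i, (t.drop 2).count i ≠ 0 → i < b := by
    intro i hi
    have h2 := List.count_pos_iff.1 (Nat.pos_of_ne_zero hi)
    have h3 := h1 i h2
    subst h3
    have := hb1 h2
    omega
  obtain ⟨α, hα, hαA⟩ := exists_isGood_eq_map_add
    (l := A.filter (fun i => b < i)) (b := b) (k := n + 1 - b) (fun i => by
      rw [count_filter_eq_ite]
      have h1 := hcount i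
      have h2 := hd i
      split_ifs at * <;> omega)
    (h.2.of_sublist (List.filter_sublist.trans (List.sublist_append_left _ _)))
  refine ⟨n + 1 - b, b - 1, by omega, by omega, α, hα, A.filter (fun i => i < b), ⟨?_, ?_⟩, ?_⟩
  · intro i
    rw [List.count_append, count_filter_eq_ite]
    have h1 := hcount i
    have h2 := hd i
    split_ifs at * <;> omega
  · exact h.2.of_sublist (List.filter_sublist.append (List.drop_sublist _ _))
  · rw [← hαA]; exact hsplit

/-- Letters of the shifted `α` exceed all later ones outside it, so no bad triple leaves that block.
A final `1` is minimal, so it never ends a 132, and it may enclose the larger `m + 1`. -/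
theorem IsGood.append {k m : ℕ} {α β t : List ℕ} (ht : t = [] ∨ t = [1])
    (hα : IsGood k α) (hβ : IsGood m (β ++ t)) :
    IsGood (k + m + 1) (α.map (· + (m + 1)) ++ (β ++ ([m + 1, m + 1] ++ t))) := by
  have hβm : ∀ i ∈ β, 1 ≤ i ∧ i ≤ m := fun i hi => hβ.mem_iff.1 (List.mem_append_left t hi)
  have htm : ∀ i ∈ t, i = 1 ∧ i ≤ m := fun i hi =>
    ⟨by rcases ht with rfl | rfl <;> simp at hi; exact hi,
      (hβ.mem_iff.1 (List.mem_append_right β hi)).2⟩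
  have hαm : ∀ i ∈ α.map (· + (m + 1)), m + 1 < i := by
    intro i hi
    obtain ⟨j, hj, rfl⟩ := List.mem_map.1 hi
    have := hα.mem_iff.1 hj
    omega
  refine ⟨fun i => ?_, ?_⟩
  · have h1 := hβ.1 i
    have h2 := hα.1 (i - (m + 1))
    simp only [List.count_append, count_map_add, List.count_cons, List.count_nil,
      beq_iff_eq] at h1 h2 ⊢
    split_ifs at * <;> omega
  · have hα' := hasGoodTriples_map_add (b := m + 1).2 hα.2
    generalize α.map (· + (m + 1)) = γ at *
    have hrest : ∀ i ∈ β ++ ([m + 1, m + 1] ++ t), i ≤ m + 1 := by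
      intro i hi
      simp only [List.mem_append, List.mem_cons, List.not_mem_nil, or_false] at hi
      rcases hi with hi | (hi | hi) | hi
      · have := hβm i hi; omega
      · omega
      · omega
      · have := htm i hi; omega
    intro x y z hs
    rcases triple_sublist_append_iff.1 hs with hs | ⟨hs, hz⟩ | ⟨hx, hs⟩ | hs
    · exact hα' x y z hs
    · have := hαm x (mem_of_pair_sublist hs).1
      have := hrest z hz
      omega
    · have := hαm x hx
      have := hrest z (mem_of_pair_sublist hs).2
      omega
    · rcases triple_sublist_append_iff.1 hs with hs | ⟨hs, hz⟩ | ⟨hx, hs⟩ | hs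
      · exact hβ.2 x y z (hs.trans (List.sublist_append_left _ _))
      · rcases List.mem_append.1 hz with hz | hz
        · have := hβm x (mem_of_pair_sublist hs).1
          have := hβm y (mem_of_pair_sublist hs).2
          simp at hz; omega
        · exact hβ.2 x y z (triple_sublist_append_iff.2 (.inr (.inl ⟨hs, hz⟩)))
      · have := hβm x hx
        rcases ht with rfl | rfl
        · have := (mem_of_pair_sublist hs).2
          have := hrest y (List.mem_append_right β (mem_of_pair_sublist hs).1)
          simp at *; omega
        · have := htm 1 (by simp)
          rcases pair_sublist_append_iff.1 hs with hs | ⟨hy, hz⟩ | hs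
          · have := mem_of_pair_sublist hs
            simp at this; omega
          · simp at hy hz; omega
          · simp at hs
      · rcases ht with rfl | rfl
        · have := hs.length_le
          simp at this
        · have := hs.eq_of_length (by simp)
          have := htm 1 (by simp)
          simp at *; omega

/-- A nonempty good word ends with `b b` or `b b 1` for some letter `b`. -/
theorem IsGood.exists_suffix {n : ℕ} {σ : List ℕ} (h : IsGood n σ) (hσ : σ ≠ []) :
    ∃ A b, σ = A ++ [b, b] ∨ σ = A ++ [b, b, 1] := by
  -- Each letter occurs twice, so a copy not repeated later has its partner earlier.
  have exists_prev : ∀ l t (c : ℕ), σ = l ++ c :: t → c ∉ t → ∃ u v, l = u ++ c :: v := by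
    intro l t c he hct
    have hc := h.mem_iff.1 (show c ∈ σ by simp [he])
    have h2 := h.1 c
    rw [if_pos hc, he] at h2
    simp only [List.count_append, List.count_cons_self, List.count_eq_zero.2 hct] at h2
    exact List.append_of_mem (List.count_pos_iff.1 (by omega))
  obtain ⟨l, y, rfl⟩ := List.eq_nil_or_concat' σ |>.resolve_left hσ
  obtain ⟨u, v, rfl⟩ := exists_prev l [] y rfl (by simp)
  rcases List.eq_nil_or_concat' v with rfl | ⟨v, x, rfl⟩
  · exact ⟨u, y, .inl (by simp)⟩
  have hyx : y < x := (h.2 y x y (by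
    simp only [List.append_assoc, List.cons_append]
    refine List.sublist_append_of_sublist_right (List.Sublist.cons_cons y ?_)
    exact List.sublist_append_of_sublist_right (by simp))).2 rfl
  have hv : ∀ i ∈ v, y < i := fun i hi => (h.2 y i y (by
    simp only [List.append_assoc, List.cons_append]
    refine List.sublist_append_of_sublist_right (List.Sublist.cons_cons y ?_)
    exact (List.singleton_sublist.2 hi).append (by simp))).2 rfl
  -- Otherwise a `1` lies before both copies of `y`, and `1 x y` is a 132.
  have hy1 : y = 1 := by
    by_contra hne
    have hy := h.mem_iff.1 (show y ∈ _ by simp)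
    have h1 := h.mem_iff.2 (show 1 ≤ 1 ∧ 1 ≤ n by omega)
    simp only [List.mem_append, List.mem_cons, List.not_mem_nil, or_false] at h1
    have h1u : 1 ∈ u := by
      rcases h1 with (h1 | h1 | h1 | h1) | h1
      · exact h1
      · omega
      · have := hv 1 h1; omega
      · omega
      · omega
    refine (h.2 1 x y ?_).1 (by omega)
    simp only [List.append_assoc, List.cons_append]
    exact (List.singleton_sublist.2 h1u).append
      (List.Sublist.cons _ (List.sublist_append_of_sublist_right (by simp)))
  subst hy1
  -- A letter `i` between the two copies of `x` would exceed `x`, and an earlier `1` would make `1 i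
  -- x` a 132; so the copies are adjacent.
  obtain ⟨u', v', hu'⟩ := exists_prev (u ++ 1 :: v) [1] x (by simp) (by simp; omega)
  have hσ' : u ++ 1 :: (v ++ [x]) ++ [1] = u' ++ x :: (v' ++ [x, 1]) := by
    have := congrArg (· ++ [x, 1]) hu'
    simpa using this
  rw [hσ'] at h ⊢
  have hv' : ∀ i ∈ v', x < i := fun i hi => (h.2 x i x (by
    refine List.sublist_append_of_sublist_right (List.Sublist.cons_cons x ?_)
    exact (List.singleton_sublist.2 hi).append (by simp))).2 rfl
  have h1 : 1 ∈ u' := by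
    have : 1 ∈ u ++ 1 :: v := by simp
    rw [hu'] at this
    simp only [List.mem_append, List.mem_cons] at this
    rcases this with h1 | h1 | h1
    · exact h1
    · omega
    · have := hv' 1 h1; omega
  rcases v' with _ | ⟨i, v'⟩
  · exact ⟨u', x, .inr rfl⟩
  · have hxi := hv' i (by simp)
    exact absurd ⟨hyx, hxi⟩ (h.2 1 i x ((List.singleton_sublist.2 h1).append
      (List.Sublist.cons _ (List.Sublist.cons_cons i
        (List.sublist_append_of_sublist_right (by simp)))))).1

/-! ### Weights of concatenated words -/

section Weight

variable {R : Type*} [CommRing R] (p q r : R)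

/-- The monomial recording the plateaus, descents and ascents of a word. -/
def weight (σ : List ℕ) : R := p ^ plat σ * q ^ des σ * r ^ asc σ

/-- The contribution of two adjacent letters to the weight of a word. -/
def stepWeight (a b : ℕ) : R := if a = b then p else if b < a then q else r

@[simp] theorem weight_nil : weight p q r [] = 1 := by simp [weight, plat, des, asc]

@[simp] theorem weight_singleton (a : ℕ) : weight p q r [a] = 1 := by
  simp [weight, plat, des, asc]

theorem weight_cons_cons (a b : ℕ) (l : List ℕ) :
    weight p q r (a :: b :: l) = stepWeight p q r a b * weight p q r (b :: l) := by
  simp only [weight, plat, des, asc, stepWeight, List.tail_cons, List.zip_cons_cons,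
    List.countP_cons, decide_eq_true_eq, gt_iff_lt]
  rcases lt_trichotomy a b with h | rfl | h
  · simp only [h, h.ne, not_lt_of_gt h, if_true, if_false]; ring
  · simp only [lt_irrefl, if_true, if_false]; ring
  · simp only [h, h.ne', not_lt_of_gt h, if_true, if_false]; ring

theorem weight_append {l m : List ℕ} {c : R} (hl : l ≠ []) (hm : m ≠ [])
    (h : ∀ x ∈ l, ∀ y ∈ m, stepWeight p q r x y = c) :
    weight p q r (l ++ m) = weight p q r l * c * weight p q r m := by
  induction l with
  | nil => exact absurd rfl hl
  | cons a l ih =>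
    rcases l with _ | ⟨b, l⟩
    · rcases m with _ | ⟨y, m⟩
      · exact absurd rfl hm
      · rw [List.singleton_append, weight_cons_cons, h a (by simp) y (by simp),
          weight_singleton, one_mul]
    · rw [List.cons_append, List.cons_append, weight_cons_cons, weight_cons_cons,
        ← List.cons_append, ih (by simp) fun x hx => h x (List.mem_cons_of_mem a hx)]
      ring

theorem weight_map_add (σ : List ℕ) (b : ℕ) :
    weight p q r (σ.map (· + b)) = weight p q r σ := by
  induction σ with
  | nil => rfl
  | cons a l ih =>
    rcases l with _ | ⟨c, l⟩
    · simp
    · simp only [List.map_cons, weight_cons_cons] at ih ⊢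
      rw [ih]
      simp [stepWeight]

/-- The weight of a word together with the descent to smaller letters following it. -/
def weightDesc (σ : List ℕ) : R := (if σ = [] then 1 else q) * weight p q r σ

theorem weight_map_add_append {k b : ℕ} {α m : List ℕ} (hα : IsGood k α) (hm : m ≠ [])
    (h : ∀ y ∈ m, y ≤ b) :
    weight p q r (α.map (· + b) ++ m) = weightDesc p q r α * weight p q r m := by
  rw [weightDesc]
  split_ifs with h0
  · simp [h0]
  · rw [weight_append p q r (c := q) (by simpa using h0) hm, weight_map_add]
    · ring
    · intro x hx y hy
      obtain ⟨j, hj, rfl⟩ := List.mem_map.1 hx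
      have := hα.mem_iff.1 hj
      have := h y hy
      rw [stepWeight, if_neg (by omega), if_pos (by omega)]

end Weight

/-! ### Bijection and recurrences -/

section Sums

open Finset

open Classical in
/-- The words `β` for which `β ++ s` is a 132-avoiding Stirling permutation of order `m`. -/
noncomputable def prefixes (m : ℕ) (s : List ℕ) : Finset (List ℕ) :=
  ((avoiders m [1, 3, 2]).filter fun σ => ∃ β, σ = β ++ s).image fun σ => σ.rdrop s.length

theorem mem_prefixes {m : ℕ} {s β : List ℕ} : β ∈ prefixes m s ↔ IsGood m (β ++ s) := by
  classical
  simp only [prefixes, mem_image, mem_filter, mem_avoiders_132_iff]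
  constructor
  · rintro ⟨_, ⟨h, β, rfl⟩, rfl⟩
    rwa [List.rdrop_append_length]
  · exact fun h => ⟨_, ⟨h, β, rfl⟩, List.rdrop_append_length⟩

theorem prefixes_nil (m : ℕ) : prefixes m [] = avoiders m [1, 3, 2] := by
  ext; rw [mem_prefixes, List.append_nil, mem_avoiders_132_iff]

/-- The last letter before `s` reveals `m`; then `β` is the part with letters at most `m`. -/
theorem map_add_append_injective {k m k' m' : ℕ} {α β α' β' s : List ℕ}
    (hα : IsGood k α) (hβ : IsGood m (β ++ s)) (hα' : IsGood k' α') (hβ' : IsGood m' (β' ++ s))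
    (h : α.map (· + (m + 1)) ++ (β ++ ([m + 1, m + 1] ++ s)) =
      α'.map (· + (m' + 1)) ++ (β' ++ ([m' + 1, m' + 1] ++ s))) :
    m = m' ∧ α = α' ∧ β = β' := by
  simp only [← List.append_assoc] at h
  have h := List.append_cancel_right h
  have hm : m = m' := by simpa using congrArg List.getLast? h
  subst hm
  have h := List.append_cancel_right h
  have key : ∀ {k α β}, IsGood k α → IsGood m (β ++ s) →
      (α.map (· + (m + 1)) ++ β).filter (fun i => i ≤ m) = β := by
    intro k α β hα hβ
    rw [List.filter_append, List.filter_eq_nil_iff.2, List.filter_eq_self.2, List.nil_append]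
    · intro i hi
      simpa using (hβ.mem_iff.1 (List.mem_append_left s hi)).2
    · intro i hi
      obtain ⟨j, hj, rfl⟩ := List.mem_map.1 hi
      simp; omega
  have hββ : β = β' := by rw [← key hα hβ, h, key hα' hβ']
  subst hββ
  exact ⟨rfl, List.map_injective_iff.2 (add_left_injective _) (List.append_cancel_right h), rfl⟩

open Classical in
theorem sum_avoiders_filter_suffix {M : Type*} [AddCommMonoid M] (n : ℕ) {s : List ℕ}
    (hs : s = [] ∨ s = [1]) (w : List ℕ → M) :
    ∑ σ ∈ (avoiders (n + 1) [1, 3, 2]).filter (fun σ => ∃ A b, σ = A ++ ([b, b] ++ s)), w σ =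
      ∑ i ∈ antidiagonal n, ∑ α ∈ avoiders i.1 [1, 3, 2], ∑ β ∈ prefixes i.2 s,
        w (α.map (· + (i.2 + 1)) ++ (β ++ ([i.2 + 1, i.2 + 1] ++ s))) := by
  simp only [← sum_product']
  rw [sum_sigma']
  symm
  refine sum_nbij (fun x => x.2.1.map (· + (x.1.2 + 1)) ++
    (x.2.2 ++ ([x.1.2 + 1, x.1.2 + 1] ++ s))) ?_ ?_ ?_ fun _ _ => rfl
  · rintro ⟨⟨k, m⟩, α, β⟩ h
    simp only [mem_sigma, HasAntidiagonal.mem_antidiagonal, mem_product, mem_avoiders_132_iff,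
      mem_prefixes] at h
    obtain ⟨rfl, hα, hβ⟩ := h
    rw [mem_filter, mem_avoiders_132_iff]
    exact ⟨hα.append hs hβ, _, m + 1, (List.append_assoc _ _ _).symm⟩
  · rintro ⟨⟨k, m⟩, α, β⟩ h ⟨⟨k', m'⟩, α', β'⟩ h' heq
    simp only [coe_sigma, Set.mem_sigma_iff, mem_coe, HasAntidiagonal.mem_antidiagonal, mem_product,
      mem_avoiders_132_iff, mem_prefixes] at h h'
    obtain ⟨rfl, rfl, rfl⟩ := map_add_append_injective h.2.1 h.2.2 h'.2.1 h'.2.2 heq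
    obtain rfl : k = k' := by omega
    rfl
  · intro σ hσ
    simp only [coe_filter, Set.mem_ofPred_eq, mem_avoiders_132_iff] at hσ
    obtain ⟨hσ, A, b, rfl⟩ := hσ
    obtain ⟨k, m, hkm, rfl, α, hα, β, hβ, rfl⟩ := hσ.exists_eq_append (b := b)
      (by rcases hs with rfl | rfl <;> simp)
    refine ⟨⟨(k, m), α, β⟩, ?_, (List.append_assoc _ _ _).symm⟩
    simp only [coe_sigma, Set.mem_sigma_iff, mem_coe, HasAntidiagonal.mem_antidiagonal, mem_product,
      mem_avoiders_132_iff, mem_prefixes]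
    exact ⟨hkm, hα, hβ⟩

variable {R : Type*} [CommRing R] (p q r : R)

theorem weight_append_pair {m : ℕ} {β : List ℕ} (h : ∀ i ∈ β, i ≤ m) :
    weight p q r (β ++ [m + 1, m + 1]) = p * if β = [] then 1 else r * weight p q r β := by
  have h2 : weight p q r [m + 1, m + 1] = p := by simp [weight_cons_cons, stepWeight]
  split_ifs with h0
  · simp [h0, h2]
  · rw [weight_append p q r (c := r) h0 (by simp), h2]
    · ring
    · intro x hx y hy
      have := h x hx
      simp at hy
      rw [stepWeight, if_neg (by omega), if_neg (by omega)]

theorem weight_append_pair_one {m : ℕ} (hm : 1 ≤ m) (β : List ℕ) :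
    weight p q r (β ++ [m + 1, m + 1, 1]) = q * weight p q r (β ++ [m + 1, m + 1]) := by
  induction β with
  | nil =>
    simp only [List.nil_append, weight_cons_cons, stepWeight, weight_singleton]
    rw [if_pos trivial, if_neg (by omega), if_pos (by omega)]; ring
  | cons a l ih =>
    rcases l with _ | ⟨b, l⟩
    · simp only [List.nil_append, List.singleton_append] at ih ⊢
      rw [weight_cons_cons, ih, weight_cons_cons p q r a]; ring
    · simp only [List.cons_append, weight_cons_cons p q r a] at ih ⊢
      rw [ih]; ring

theorem IsGood.ne_nil_of_append_one {m : ℕ} {β : List ℕ} (h : IsGood m (β ++ [1])) :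
    β ≠ [] ∧ 1 ≤ m := by
  have hm := h.mem_iff.1 (show 1 ∈ β ++ [1] by simp)
  refine ⟨?_, hm.2⟩
  rintro rfl
  have := h.1 1
  rw [if_pos hm] at this
  simp at this

/-- The total weight of the 132-avoiding Stirling permutations of order `n`, each counted with
the descent to smaller letters following it. -/
noncomputable def descPoly (n : ℕ) : R := ∑ σ ∈ avoiders n [1, 3, 2], weightDesc p q r σ

/-- The total weight of the words that become 132-avoiding Stirling permutations of order `n`
on appending a letter `1`. -/
noncomputable def prefixPoly (n : ℕ) : R := ∑ σ ∈ prefixes n [1], weight p q r σ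

theorem avoidPoly_eq_sum_weight (n : ℕ) :
    avoidPoly n [1, 3, 2] p q r = ∑ σ ∈ avoiders n [1, 3, 2], weight p q r σ := rfl

theorem avoiders_zero : avoiders 0 [1, 3, 2] = {[]} := by
  ext σ; rw [mem_avoiders_132_iff, isGood_zero_iff, mem_singleton]

theorem IsGood.ne_nil {n : ℕ} {σ : List ℕ} (h : IsGood (n + 1) σ) : σ ≠ [] :=
  List.ne_nil_of_mem (h.mem_iff.2 ⟨le_rfl, by omega⟩)

theorem avoidPoly_zero : avoidPoly 0 [1, 3, 2] p q r = 1 := by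
  rw [avoidPoly_eq_sum_weight, avoiders_zero, sum_singleton, weight_nil]

theorem descPoly_zero : descPoly p q r 0 = 1 := by
  simp [descPoly, avoiders_zero, weightDesc]

theorem descPoly_succ (n : ℕ) :
    descPoly p q r (n + 1) = q * avoidPoly (n + 1) [1, 3, 2] p q r := by
  rw [descPoly, avoidPoly_eq_sum_weight, mul_sum]
  refine sum_congr rfl fun σ hσ => ?_
  rw [weightDesc, if_neg (mem_avoiders_132_iff.1 hσ).ne_nil]

theorem prefixPoly_zero : prefixPoly p q r 0 = 0 := by
  rw [prefixPoly]
  refine sum_eq_zero fun σ hσ => ?_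
  have := isGood_zero_iff.1 (mem_prefixes.1 hσ)
  simp at this

theorem avoidPoly_succ (n : ℕ) :
    avoidPoly (n + 1) [1, 3, 2] p q r =
      (∑ i ∈ antidiagonal n, descPoly p q r i.1 *
        (p * if i.2 = 0 then 1 else r * avoidPoly i.2 [1, 3, 2] p q r)) +
      ∑ i ∈ antidiagonal n, descPoly p q r i.1 * (p * q * r * prefixPoly p q r i.2) := by
  classical
  rw [avoidPoly_eq_sum_weight, ← sum_filter_add_sum_filter_not _
    (fun σ => ∃ A b, σ = A ++ ([b, b] ++ []))]
  congr 1
  · rw [sum_avoiders_filter_suffix n (.inl rfl)]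
    refine sum_congr rfl fun i _ => ?_
    rw [descPoly, sum_mul]
    refine sum_congr rfl fun α hα => ?_
    rw [prefixes_nil]
    have h : ∀ β ∈ avoiders i.2 [1, 3, 2],
        weight p q r (α.map (· + (i.2 + 1)) ++ (β ++ ([i.2 + 1, i.2 + 1] ++ []))) =
          weightDesc p q r α * (p * if i.2 = 0 then 1 else r * weight p q r β) := by
      intro β hβ
      rw [mem_avoiders_132_iff] at hα hβ
      have hβm : ∀ j ∈ β, j ≤ i.2 := fun j hj => (hβ.mem_iff.1 hj).2
      rw [List.append_nil, weight_map_add_append p q r hα (by simp), weight_append_pair p q r hβm]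
      -- Only order 0 contains the empty word, so the missing ascent depends on `i.2` alone.
      · have : β = [] ↔ i.2 = 0 := by
          constructor
          · rintro rfl
            by_contra h0
            obtain ⟨j, hj⟩ := Nat.exists_eq_succ_of_ne_zero h0
            exact (hj ▸ hβ).ne_nil rfl
          · intro h0
            rw [h0] at hβ
            exact isGood_zero_iff.1 hβ
        simp only [this]
      · intro j hj
        simp only [List.mem_append, List.mem_cons, List.not_mem_nil, or_false, or_self] at hj
        rcases hj with hj | hj
        · have := hβm j hj; omega
        · exact hj.le
    rw [sum_congr rfl h, ← mul_sum, ← mul_sum]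
    split_ifs with h0
    · rw [h0, avoiders_zero, sum_singleton]
    · rw [← mul_sum, avoidPoly_eq_sum_weight]
  · have hfilter : (avoiders (n + 1) [1, 3, 2]).filter (fun σ => ¬∃ A b, σ = A ++ ([b, b] ++ [])) =
        (avoiders (n + 1) [1, 3, 2]).filter (fun σ => ∃ A b, σ = A ++ ([b, b] ++ [1])) := by
      refine filter_congr fun σ hσ => ?_
      rw [mem_avoiders_132_iff] at hσ
      constructor
      · intro h
        obtain ⟨A, b, rfl | rfl⟩ := hσ.exists_suffix hσ.ne_nil
        · exact absurd ⟨A, b, rfl⟩ h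
        · exact ⟨A, b, rfl⟩
      -- A word with both endings would contain `1` three times.
      · rintro ⟨A, b, rfl⟩ ⟨A', b', h⟩
        have h : (A ++ [b]) ++ [b, 1] = A' ++ [b', b'] := by simpa using h
        have h := (List.append_inj' h rfl).2
        simp only [List.cons.injEq, and_true] at h
        obtain rfl : b = 1 := by omega
        have := hσ.1 1
        simp at this
    rw [hfilter, sum_avoiders_filter_suffix n (.inr rfl)]
    refine sum_congr rfl fun i _ => ?_
    rw [descPoly, prefixPoly, sum_mul]
    refine sum_congr rfl fun α hα => ?_
    rw [mul_sum, mul_sum]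
    refine sum_congr rfl fun β hβ => ?_
    rw [mem_avoiders_132_iff] at hα
    rw [mem_prefixes] at hβ
    have hβm : ∀ j ∈ β, j ≤ i.2 := fun j hj => (hβ.mem_iff.1 (List.mem_append_left _ hj)).2
    obtain ⟨hne, hm⟩ := hβ.ne_nil_of_append_one
    rw [weight_map_add_append p q r hα (by simp), List.cons_append, List.cons_append,
      List.nil_append, weight_append_pair_one p q r hm, weight_append_pair p q r hβm, if_neg hne]
    · ring
    · intro j hj
      simp only [List.mem_append, List.mem_cons, List.not_mem_nil, or_false] at hj
      rcases hj with hj | (hj | hj) | hj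
      · have := hβm j hj; omega
      all_goals omega

open Classical in
theorem sum_prefixes {M : Type*} [AddCommMonoid M] (m : ℕ) (s : List ℕ) (w : List ℕ → M) :
    ∑ β ∈ prefixes m s, w β =
      ∑ σ ∈ (avoiders m [1, 3, 2]).filter (fun σ => ∃ β, σ = β ++ s), w (σ.rdrop s.length) := by
  rw [prefixes, sum_image]
  · intro σ hσ τ hτ h
    simp only [coe_filter, Set.mem_ofPred_eq] at hσ hτ
    obtain ⟨-, β, rfl⟩ := hσ
    obtain ⟨-, γ, rfl⟩ := hτ
    simp only [List.rdrop_append_length] at h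
    rw [h]

/-- Deleting the final `1` from `α' 1 1` leaves `α' 1`, of weight `weightDesc α`; deleting it from
`α' β b b 1` removes the final descent, hence no factor `q`. -/
theorem prefixPoly_succ (n : ℕ) :
    prefixPoly p q r (n + 1) = descPoly p q r n +
      ∑ i ∈ antidiagonal n, descPoly p q r i.1 * (p * r * prefixPoly p q r i.2) := by
  classical
  rw [prefixPoly, sum_prefixes, ← sum_filter_add_sum_filter_not _
    (fun σ => ∃ A b, σ = A ++ ([b, b] ++ [1])), add_comm, filter_filter, filter_filter]
  congr 1
  · rw [descPoly]
    symm
    refine sum_nbij (fun α => α.map (· + 1) ++ [1, 1]) ?_ ?_ ?_ ?_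
    · intro α hα
      rw [mem_avoiders_132_iff] at hα
      have h := hα.append (.inl rfl) (show IsGood 0 ([] ++ []) from isGood_zero_iff.2 rfl)
      rw [mem_filter, mem_avoiders_132_iff]
      refine ⟨by simpa using h, ⟨α.map (· + 1) ++ [1], by simp⟩, ?_⟩
      rintro ⟨A, b, hA⟩
      have hA' : α.map (· + 1) ++ [1] = (A ++ [b]) ++ [b] :=
        List.append_cancel_right (bs := [1]) (by simpa using hA)
      obtain rfl : 1 = b := by simpa using congrArg List.getLast? hA'
      have hcount := h.1 1
      rw [if_pos (by omega)] at hcount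
      have := congrArg (List.count 1) hA
      simp at hcount this
      omega
    · intro α _ α' _ h
      exact List.map_injective_iff.2 (add_left_injective _) (List.append_cancel_right h)
    · intro σ hσ
      simp only [coe_filter, Set.mem_ofPred_eq, mem_avoiders_132_iff] at hσ
      obtain ⟨hσ, ⟨β, rfl⟩, hnot⟩ := hσ
      obtain ⟨A, b, h | h⟩ := hσ.exists_suffix hσ.ne_nil
      · obtain rfl : 1 = b := by simpa using congrArg List.getLast? h
        rw [h] at hσ ⊢
        obtain ⟨k, m, hkm, h1, α, hα, γ, hγ, rfl⟩ := hσ.exists_eq_append (.inl rfl)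
        obtain rfl : m = 0 := by omega
        obtain rfl : k = n := by omega
        have := isGood_zero_iff.1 hγ
        simp only [List.append_eq_nil_iff] at this
        refine ⟨α, by simpa [mem_avoiders_132_iff] using hα, by simp [this.1]⟩
      · exact absurd ⟨A, b, h⟩ hnot
    · intro α hα
      rw [mem_avoiders_132_iff] at hα
      have h : (α.map (· + 1) ++ [1, 1]).rdrop [1].length = α.map (· + 1) ++ [1] := by
        rw [List.append_cons, List.rdrop_append_length]
      rw [h, weight_map_add_append p q r hα (by simp) (by simp), weight_singleton, mul_one]
  · have hfilter : (avoiders (n + 1) [1, 3, 2]).filter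
        (fun σ => (∃ β, σ = β ++ [1]) ∧ ∃ A b, σ = A ++ ([b, b] ++ [1])) =
        (avoiders (n + 1) [1, 3, 2]).filter (fun σ => ∃ A b, σ = A ++ ([b, b] ++ [1])) := by
      refine filter_congr fun σ _ => and_iff_right_of_imp ?_
      rintro ⟨A, b, rfl⟩
      exact ⟨A ++ [b, b], (List.append_assoc _ _ _).symm⟩
    rw [hfilter, sum_avoiders_filter_suffix n (.inr rfl)]
    refine sum_congr rfl fun i _ => ?_
    rw [descPoly, prefixPoly, sum_mul]
    refine sum_congr rfl fun α hα => ?_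
    rw [mul_sum, mul_sum]
    refine sum_congr rfl fun β hβ => ?_
    rw [mem_avoiders_132_iff] at hα
    rw [mem_prefixes] at hβ
    have hβm : ∀ j ∈ β, j ≤ i.2 := fun j hj => (hβ.mem_iff.1 (List.mem_append_left _ hj)).2
    rw [← List.append_assoc β, ← List.append_assoc, List.rdrop_append_length,
      weight_map_add_append p q r hα (by simp), weight_append_pair p q r hβm,
      if_neg hβ.ne_nil_of_append_one.1]
    · ring
    · intro j hj
      simp only [List.mem_append, List.mem_cons, List.not_mem_nil, or_false] at hj
      rcases hj with hj | hj | hj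
      · have := hβm j hj; omega
      all_goals omega

end Sums
end StirlingPerm

/-! ### The functional equation -/

open StirlingPerm in
theorem theorem8 {R : Type*} [CommRing R] (p q r : R) (f : PowerSeries R)
    (hf : f = C q * StirlingPerm.genFun [1, 3, 2] p q r - C q + 1) :
    f = 1 + C p * X * (C q - 2 * C r + C r * (2 + C (p * r - p * q + q ^ 2) * X) * f
      - C p * C r ^ 2 * X * f ^ 2) * f := by
  set G := StirlingPerm.genFun [1, 3, 2] p q r with hG
  set E : PowerSeries R := PowerSeries.mk (prefixPoly p q r) with hE
  have hfd : f = PowerSeries.mk (descPoly p q r) := by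
    rw [hf]
    ext n
    rcases n with _ | n
    · simp [hG, genFun, avoidPoly_zero, descPoly_zero]
    · simp [hG, genFun, descPoly_succ, coeff_one]
  have hEeq : E = X * f + C (p * r) * (X * (f * E)) := by
    ext n
    rcases n with _ | n
    · simp [hE, prefixPoly_zero]
    · rw [map_add, coeff_C_mul, coeff_succ_X_mul, coeff_succ_X_mul, coeff_mul, hfd, hE]
      simp only [coeff_mk]
      rw [prefixPoly_succ, Finset.mul_sum]
      congr 1
      exact Finset.sum_congr rfl fun i _ => by ring
  have hGeq : G = 1 + C p * (X * (f * (1 + C r * (G - 1)))) +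
      C (p * q * r) * (X * (f * E)) := by
    ext n
    rcases n with _ | n
    · simp [hG, genFun, avoidPoly_zero]
    · rw [map_add, map_add, coeff_C_mul, coeff_C_mul, coeff_succ_X_mul, coeff_succ_X_mul,
        coeff_mul, coeff_mul, hfd, hE, coeff_one, if_neg n.succ_ne_zero, zero_add]
      simp only [coeff_mk, hG, genFun]
      rw [avoidPoly_succ, Finset.mul_sum, Finset.mul_sum]
      congr 1
      · refine Finset.sum_congr rfl fun i _ => ?_
        simp only [map_add, coeff_C_mul, map_sub, coeff_mk, coeff_one]
        split_ifs with h
        · rw [h, avoidPoly_zero]; ring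
        · ring
      · exact Finset.sum_congr rfl fun i _ => by ring
  clear_value G E
  clear hfd
  simp only [map_mul, map_sub, map_add, map_pow] at hEeq hGeq ⊢
  -- One factor `1 - p r x f` serves to eliminate `G`, the other `E`; nothing has to be inverted.
  linear_combination (1 - C p * C r * X * f) ^ 2 * hf + C q * (1 - C p * C r * X * f) * hGeq +
    C q * (C p * C q * C r * X * f) * hEeq
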